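/- Let $s,k\ge 0$ be integers, $m=s+k$, $\delta\in[0,1]$, and let $\rho_{ABB'}$ be a density operator on three systems $A,B,B'$ of $m$ qubits each. Let $\theta$ be uniformly distributed on $\Theta=\{\theta\in\{0,1\}^m:\omega(\theta)=k\}$ ($\omega$ is the Hamming weight), recorded in a register $S^\Theta$, and let $\mathcal I=\{i:\theta_i=0\}$. All qubits of $B$ are measured in the Hadamard basis, with outcome $Y\in\{0,1\}^s$ on the qubits in $\mathcal I$ and $W\in\{0,1\}^k$ on the qubits in $\bar{\mathcal I}$; the qubits of $A$ in $\bar{\mathcal I}$ are measured in the Hadamard basis, with outcome $V\in\{0,1\}^k$. The qubits of $A$ in $\mathcal I$ are measured either in the computational basis, with outcome $X\in\{0,1\}^s$, giving the state $\sigma_{VWXYS^\Theta}$, or (hypothetically) in the Hadamard basis, with outcome $Z\in\{0,1\}^s$, giving the state $\hat\sigma_{VWZYS^\Theta}$. Put $F^{\mathrm{comp}}=1$ if $\omega(V\oplus W)<k\delta$ and $F^{\mathrm{comp}}=0$ otherwise. For a bipartite positive semidefinite $\rho_{AB}$ let $$H_{\min}(A|B)_\rho=\sup\{\xi\in\mathbb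 R:\ \rho_{AB}\le 2^{-\xi}\,1_A\otimes\sigma_B\text{ for some density operator }\sigma_B\},$$ let $H_{\max}(A|B)_\rho=-H_{\min}(A|C)_\rho$ for any purification $\rho_{ABC}$ of $\rho_{AB}$, and let $$H^{\epsilon}_{\max}(A|B)_\rho=\inf\{H_{\max}(A|B)_{\tilde\rho}:\ \tilde\rho_{AB}\ge 0,\ \mathrm{Tr}\,\tilde\rho_{AB}\le 1,\ P(\tilde\rho_{AB},\rho_{AB})\le\epsilon\},$$ where $P(\rho,\sigma)=\sqrt{1-F(\rho,\sigma)}$ is the purified distance and $F(\rho,\sigma)=\bigl(\mathrm{Tr}\sqrt{\sqrt\rho\,\sigma\sqrt\rho}+\sqrt{1-\mathrm{Tr}\rho}\sqrt{1-\mathrm{Tr}\sigma}\bigr)^2$ is the generalized fidelity. Write $H^{\epsilon}_{\max}(Z\wedge F^{\mathrm{comp}}=1|Y)_{\hat\sigma}$ for the smooth max-entropy of the subnormalized (not renormalized) state of $Z,Y$ obtained from $\hat\sigma$ by restricting to the event $F^{\mathrm{comp}}=1$ and discarding $V,W,S^\Theta$. Let $\epsilon(\nu)=\exp\left(\frac{-sk^2\nu^2}{m(k+1)}\right)$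 and $h(x)=-x\log_2x-(1-x)\log_2(1-x)$. Then $\Pr[F^{\mathrm{comp}}=1]_\sigma=\Pr[F^{\mathrm{comp}}=1]_{\hat\sigma}$, and for every $\nu\in(0,\tfrac12-\delta]$ with $\epsilon(\nu)^2<\Pr[F^{\mathrm{comp}}=1]_\sigma$, $$H^{\epsilon(\nu)}_{\max}(Z\wedge F^{\mathrm{comp}}=1\mid Y)_{\hat\sigma}\le s\cdot h(\delta+\nu).$$ (If $m=0$, no $\nu$ satisfies the condition, with the exponent read as $0$.) -/

import Mathlib

open scoped Kronecker ComplexOrder MatrixOrder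

noncomputable section

namespace CertDel

/-! ### States, partial traces, distances -/

section States

variable {A B C : Type*} [Fintype A] [DecidableEq A] [Fintype B] [DecidableEq B]
  [Fintype C] [DecidableEq C]

/-- Density operators (normalized states) on the finite-dimensional space `ℂ^A`. -/
def IsDensity (ρ : Matrix A A ℂ) : Prop :=
  ρ.PosSemidef ∧ ρ.trace = 1

/-- Subnormalized states: positive semidefinite operators of trace at most one. -/
def IsSubnormalized (ρ : Matrix A A ℂ) : Prop :=
  ρ.PosSemidef ∧ ρ.trace.re ≤ 1

/-- The rank-one operator `|ψ⟩⟨ψ|`. -/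
def pureState (ψ : A → ℂ) : Matrix A A ℂ :=
  Matrix.vecMulVec ψ (star ψ)

/-- Partial trace over the last system of a tripartite operator. -/
def traceOutLast (ρ : Matrix (A × B × C) (A × B × C) ℂ) : Matrix (A × B) (A × B) ℂ :=
  Matrix.of fun p q => ∑ c, ρ (p.1, p.2, c) (q.1, q.2, c)

/-- Partial trace over the middle system of a tripartite operator. -/
def traceOutMid (ρ : Matrix (A × B × C) (A × B × C) ℂ) : Matrix (A × C) (A × C) ℂ :=
  Matrix.of fun p q => ∑ b, ρ (p.1, b, p.2) (q.1, b, q.2)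

/-- Generalized fidelity of two subnormalized states,
`F(ρ, σ) = (Tr √(√ρ σ √ρ) + √(1 - Tr ρ) √(1 - Tr σ))²`. -/
def genFidelity (ρ σ : Matrix A A ℂ) : ℝ :=
  ((CFC.sqrt (CFC.sqrt ρ * σ * CFC.sqrt ρ)).trace.re
    + √(1 - ρ.trace.re) * √(1 - σ.trace.re)) ^ 2

/-- Purified distance `P(ρ, σ) = √(1 - F(ρ, σ))`. -/
def purifiedDist (ρ σ : Matrix A A ℂ) : ℝ :=
  √(1 - genFidelity ρ σ)

/-! ### Entropies -/

/-- Min-entropy `H_min(A|B)_ρ`: the supremum of the real `ξ` such that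
`ρ_AB ≤ 2^(-ξ) 1_A ⊗ σ_B` for some state `σ_B`. -/
def condMinEntropy (ρ : Matrix (A × B) (A × B) ℂ) : EReal :=
  sSup {x : EReal | ∃ ξ : ℝ, x = (ξ : EReal) ∧ ∃ σ : Matrix B B ℂ, IsDensity σ ∧
    (((2 : ℝ) ^ (-ξ)) • ((1 : Matrix A A ℂ) ⊗ₖ σ) - ρ).PosSemidef}

/-- `ψ` is a purification of `ρ_AB` with purifying system `C`. -/
def IsPurification (ψ : A × B × C → ℂ) (ρ : Matrix (A × B) (A × B) ℂ) : Prop :=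
  traceOutLast (pureState ψ) = ρ

/-- Every positive semidefinite operator has a purification. -/
theorem exists_isPurification (ρ : Matrix (A × B) (A × B) ℂ) (hρ : ρ.PosSemidef) :
    ∃ (n : ℕ) (ψ : A × B × Fin (n + 1) → ℂ), IsPurification ψ ρ := by
  obtain ⟨M, hM⟩ : ∃ M : Matrix (A × B) (A × B) ℂ, ρ = M * M.conjTranspose := by
    refine ⟨CFC.sqrt ρ, ?_⟩
    have h1 := CFC.sqrt_mul_sqrt_self ρ hρ.nonneg
    have h2 : (CFC.sqrt ρ).conjTranspose = CFC.sqrt ρ :=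
      (Matrix.nonneg_iff_posSemidef.mp (CFC.sqrt_nonneg ρ)).1
    rw [h2, h1]
  let e : Option (A × B) ≃ Fin (Fintype.card (A × B) + 1) :=
    Fintype.equivFinOfCardEq (by simp)
  refine ⟨Fintype.card (A × B),
    fun x => (e.symm x.2.2).elim 0 (fun d => M (x.1, x.2.1) d), ?_⟩
  ext p q
  simp only [traceOutLast, pureState, Matrix.of_apply, Matrix.vecMulVec_apply, hM,
    Matrix.mul_apply, Matrix.conjTranspose_apply, Pi.star_apply]
  rw [← Equiv.sum_comp e]
  simp

/-- Max-entropy `H_max(A|B)_ρ = -H_min(A|C)_ρ`, where `ρ_ABC` is a purification of `ρ_AB` with some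
nonzero finite-dimensional purifying system `C`. The value does not depend on the purification;
formally we take the supremum over all of them. -/
def condMaxEntropy (ρ : Matrix (A × B) (A × B) ℂ) : EReal :=
  ⨆ (n : ℕ) (ψ : A × B × Fin (n + 1) → ℂ) (_ : IsPurification ψ ρ),
    -condMinEntropy (traceOutMid (pureState ψ))

/-- Smooth max-entropy `H_max^ε(A|B)_ρ`: the infimum of `H_max(A|B)` over all subnormalized states
within purified distance `ε` of `ρ_AB`. -/
def smoothCondMaxEntropy (ε : ℝ) (ρ : Matrix (A × B) (A × B) ℂ) : EReal :=
  ⨅ (ρ' : Matrix (A × B) (A × B) ℂ) (_ : IsSubnormalized ρ') (_ : purifiedDist ρ' ρ ≤ ε),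
    condMaxEntropy ρ'

end States

/-! ### Bit strings and bases -/

/-- Bit strings of length `n`; this also indexes the standard basis of `n` qubits. -/
abbrev Bits (n : ℕ) : Type := Fin n → Bool

/-- Hamming weight. -/
def hammingWeight {n : ℕ} (x : Bits n) : ℕ :=
  (Finset.univ.filter fun i => x i = true).card

/-- Bitwise exclusive or. -/
def bitXor {n : ℕ} (x y : Bits n) : Bits n := fun i => xor (x i) (y i)

/-- The set `Θ` of basis strings of length `s + k` and Hamming weight `k`. -/
abbrev BasisSeed (s k : ℕ) : Type := {θ : Bits (s + k) // hammingWeight θ = k}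

instance (s k : ℕ) : DecidableEq (BasisSeed s k) := inferInstance

/-- The positions `𝓘 = {i | θ_i = 0}`, listed increasingly. -/
def posI {s k : ℕ} (θ : BasisSeed s k) : Fin s ↪o Fin (s + k) :=
  (Finset.univ.filter fun i => θ.1 i = false).orderEmbOfFin (by
    have h := Finset.card_filter_add_card_filter_not (s := (Finset.univ : Finset (Fin (s + k))))
      (fun i => θ.1 i = true)
    have h2 : (Finset.univ.filter fun i => θ.1 i = true).card = k := θ.2
    simp only [Bool.not_eq_true, Finset.card_univ, Fintype.card_fin] at h
    omega)

/-- The complementary positions `{i | θ_i = 1}`, listed increasingly. -/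
def posIbar {s k : ℕ} (θ : BasisSeed s k) : Fin k ↪o Fin (s + k) :=
  (Finset.univ.filter fun i => θ.1 i = true).orderEmbOfFin θ.2

/-! ### Measurements -/

/-- The Hadamard operator. -/
def hadamard : Matrix Bool Bool ℂ :=
  Matrix.of fun x y => ((1 / √2 : ℝ) : ℂ) * (if x && y then -1 else 1)

/-- The single-qubit measurement operator `M^{b,x} = H^b |x⟩⟨x| H^b`: computational basis for
`b = false`, Hadamard basis for `b = true`. -/
def qubitMeas (b x : Bool) : Matrix Bool Bool ℂ :=
  if b then hadamard * Matrix.single x x 1 * hadamard else Matrix.single x x 1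

/-- The operator on `m` qubits that is `⊗_j M^{b, x_j}` on the qubits `e 0, e 1, …`
(the `j`-th factor acting on qubit `e j`) and the identity on all other qubits. -/
def measOn {m l : ℕ} (e : Fin l ↪o Fin m) (b : Bool) (x : Bits l) :
    Matrix (Bits m) (Bits m) ℂ :=
  Matrix.of fun f g => (∏ j, qubitMeas b (x j) (f (e j)) (g (e j))) *
    (if ∀ i, i ∉ Set.range e → f i = g i then 1 else 0)

/-- The index set of the standard basis of the systems `A`, `B`, `B'` of `m` qubits each. -/
abbrev ABB' (m : ℕ) : Type := Bits m × Bits m × Bits m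

/-- The registers `V, W, Z, Y, S^Θ` (or `V, W, X, Y, S^Θ`). -/
abbrev Registers (s k : ℕ) : Type := Bits k × Bits k × Bits s × Bits s × BasisSeed s k

/-- The total measurement operator for the seed `θ`: on `A`, the qubits outside `𝓘` are measured in
the Hadamard basis (outcome `v`) and those in `𝓘` in basis `b` (outcome `z`); on `B`, all qubits
are measured in the Hadamard basis (outcome `y` on `𝓘`, outcome `w` outside); `B'` is untouched. -/
def totalMeas {s k : ℕ} (b : Bool) : Registers s k → Matrix (ABB' (s + k)) (ABB' (s + k)) ℂ
  | (v, w, z, y, θ) =>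
    (measOn (posI θ) b z * measOn (posIbar θ) true v) ⊗ₖ
      ((measOn (posI θ) true y * measOn (posIbar θ) true w) ⊗ₖ (1 : Matrix (Bits (s + k)) _ ℂ))

/-- The post-measurement state of the classical registers when the seed `θ` is uniform on `Θ` and
the systems `A, B, B'` are finally discarded. For `b = false` (qubits of `A` in `𝓘` measured in the
computational basis) this is the actual state `σ_{VWXYS^Θ}`; for `b = true` (Hadamard basis)
it is the hypothetical state `σ̂_{VWZYS^Θ}`. -/
def postMeasState {s k : ℕ} (b : Bool) (ρ : Matrix (ABB' (s + k)) (ABB' (s + k)) ℂ) :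
    Matrix (Registers s k) (Registers s k) ℂ :=
  Matrix.diagonal fun r =>
    (((s + k).choose k : ℂ))⁻¹ * (totalMeas b r * ρ * (totalMeas b r).conjTranspose).trace

/-! ### The comparison test -/

/-- The comparison test: it is passed if `v` and `w` differ in less than `k δ` positions. -/
def comp {k : ℕ} (δ : ℝ) (v w : Bits k) : Prop :=
  (hammingWeight (bitXor v w) : ℝ) < k * δ

open Classical in
/-- The probability `Pr[F^comp = 1]` in a state of the registers. -/
def probComp {s k : ℕ} (δ : ℝ) (σ : Matrix (Registers s k) (Registers s k) ℂ) : ℝ :=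
  ∑ r : Registers s k, if comp δ r.1 r.2.1 then (σ r r).re else 0

open Classical in
/-- The subnormalized state of the registers `Z, Y` on the event `F^comp = 1`: the state is
restricted to this event, without renormalization, and `V, W, S^Θ` are traced out. -/
def stateZYComp {s k : ℕ} (δ : ℝ) (σ : Matrix (Registers s k) (Registers s k) ℂ) :
    Matrix (Bits s × Bits s) (Bits s × Bits s) ℂ :=
  Matrix.of fun p q => ∑ v : Bits k, ∑ w : Bits k, ∑ θ : BasisSeed s k,
    if comp δ v w then σ (v, w, p.1, p.2, θ) (v, w, q.1, q.2, θ) else 0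

/-! ### Rates -/

/-- `ε(ν) = exp(-s k² ν² / (m (k + 1)))` with `m = s + k`. -/
def smoothingParam (s k : ℕ) (ν : ℝ) : ℝ :=
  Real.exp (-(s * (k : ℝ) ^ 2 * ν ^ 2) / (((s : ℝ) + k) * (k + 1)))

/-- Binary entropy, with logarithms to base two. -/
def binEnt (x : ℝ) : ℝ :=
  -x * Real.logb 2 x - (1 - x) * Real.logb 2 (1 - x)

end CertDel

end

noncomputable section

namespace CertDel

/-! ### Serfling's inequality for sampling without replacement -/

section Sampling

/-! The passing probability involves only `V` and `W`; summing over the outcomes on `𝓘` of `A`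
removes the corresponding measurement, so its basis is irrelevant (`sum_outcomeProb`,
`probComp_postMeasState`).

For the entropy bound, note that in the hypothetical experiment every qubit of `A` and `B` is
measured in the Hadamard basis. The outcomes are then two strings `a`, `b` whose law `jointProb`
does not depend on the seed, and the seed only decides how they are cut into `Z, V` and `Y, W`
(`outcomeProb_true`, `sum_passProb_filter`). For fixed `a`, `b`, passing the test while `Z` and `Y`
differ in more than a fraction `δ + ν` of the positions is a failure of sampling without
replacement, applied to the set where `a` and `b` differ. Serfling's inequality (`card_sample_le`)
bounds the fraction of such seeds by `ε(ν)²`, and averaging over `a`, `b` bounds the weight `e` of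
these bad pairs by `ε(ν)²`.

Discarding the bad pairs and dividing by `1 - e` moves the state by exactly `√e ≤ ε(ν)` in purified
distance (`purifiedDist_restrict`). In the new state, given `Y = y`, the string `Z` lies in a
Hamming ball around `y` of at most `2^(s h(δ + ν))` elements (`card_closePairs_le`). Such a bound on
the conditional support bounds the max-entropy (`condMaxEntropy_le`): in a purification, the
pinching inequality gives `ρ_AC ≤ N 1_A ⊗ ρ_C`, where `N` bounds the number of values of `A` for
each value of `B`. -/

open MeasureTheory ProbabilityTheory in
/-- Hoeffding's lemma for a centred Bernoulli variable. -/
theorem bernoulli_mgf_le {p : ℝ} (hp0 : 0 ≤ p) (hp1 : p ≤ 1) (l : ℝ) :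
    p * Real.exp (l * (1 - p)) + (1 - p) * Real.exp (-(l * p)) ≤ Real.exp (l ^ 2 / 8) := by
  let μ : Measure Bool :=
    ENNReal.ofReal p • Measure.dirac true + ENNReal.ofReal (1 - p) • Measure.dirac false
  let X : Bool → ℝ := fun b => if b then 1 - p else -p
  have hq : 0 ≤ 1 - p := by linarith
  have : IsProbabilityMeasure μ := ⟨by
    simp only [μ, Measure.add_apply, Measure.smul_apply, measure_univ, smul_eq_mul, mul_one]
    rw [← ENNReal.ofReal_add hp0 hq]; simp⟩
  have hint : ∀ f : Bool → ℝ, ∫ b, f b ∂μ = p * f true + (1 - p) * f false := fun f => by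
    simp only [μ]
    have := (Measure.dirac true : Measure Bool).smul_finite (ENNReal.ofReal_ne_top (r := p))
    have := (Measure.dirac false : Measure Bool).smul_finite (ENNReal.ofReal_ne_top (r := 1 - p))
    rw [integral_add_measure (.of_finite) (.of_finite), integral_smul_measure,
      integral_smul_measure, integral_dirac, integral_dirac, ENNReal.toReal_ofReal hp0,
      ENNReal.toReal_ofReal hq]
    simp
  -- The values lie in an interval of length one, so the variance proxy is `1/4`; this is the source
  -- of `l ^ 2 / 8`.
  have hX : HasSubgaussianMGF X ((‖(1 - p) - (-p)‖₊ / 2) ^ 2) μ := by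
    refine hasSubgaussianMGF_of_mem_Icc_of_integral_eq_zero
      (measurable_of_finite X).aemeasurable (.of_forall fun b => ?_) ?_
    · cases b <;> simp [X]
    · rw [hint]; simp [X]; ring
  have h := hX.mgf_le l
  rw [mgf, hint] at h
  have e1 : (1 - p) - (-p) = 1 := by ring
  rw [e1] at h
  simp only [X, if_true, nnnorm_one, Bool.false_eq_true, if_false] at h
  refine le_trans (le_of_eq ?_) (h.trans (le_of_eq ?_))
  · ring_nf
  · congr 1; push_cast; ring

variable {ι : Type*} [Fintype ι] [DecidableEq ι]

/-- Double counting of pairs of an `n + 1`-element set and one of its elements. -/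
theorem sum_powersetCard_succ (n : ℕ) (F : Finset ι → ℝ) :
    ((n : ℝ) + 1) * ∑ I ∈ Finset.powersetCard (n + 1) (Finset.univ : Finset ι), F I
      = ∑ I ∈ Finset.powersetCard n (Finset.univ : Finset ι), ∑ i ∈ Iᶜ, F (insert i I) := by
  have h1 : ((n : ℝ) + 1) * ∑ I ∈ Finset.powersetCard (n + 1) (Finset.univ : Finset ι), F I
      = ∑ I ∈ Finset.powersetCard (n + 1) (Finset.univ : Finset ι), ∑ _i ∈ I, F I := by
    rw [Finset.mul_sum]
    refine Finset.sum_congr rfl fun I hI => ?_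
    rw [Finset.sum_const, (Finset.mem_powersetCard.mp hI).2, nsmul_eq_mul]
    push_cast; rfl
  rw [h1, Finset.sum_sigma', Finset.sum_sigma']
  refine Finset.sum_bij' (fun x _ => ⟨x.1.erase x.2, x.2⟩) (fun x _ => ⟨insert x.2 x.1, x.2⟩)
    ?_ ?_ ?_ ?_ ?_
  · rintro ⟨I, i⟩ h
    simp only [Finset.mem_sigma, Finset.mem_powersetCard, Finset.subset_univ, true_and] at h
    simp [Finset.mem_powersetCard, Finset.card_erase_of_mem h.2, h.1]
  · rintro ⟨I, i⟩ h
    simp only [Finset.mem_sigma, Finset.mem_powersetCard, Finset.subset_univ, true_and,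
      Finset.mem_compl] at h
    simp [Finset.mem_powersetCard, Finset.card_insert_of_notMem h.2, h.1]
  · rintro ⟨I, i⟩ h
    simp only [Finset.mem_sigma] at h
    simp [Finset.insert_erase h.2]
  · rintro ⟨I, i⟩ h
    simp only [Finset.mem_sigma, Finset.mem_compl] at h
    simp [Finset.erase_insert h.2]
  · rintro ⟨I, i⟩ h
    simp only [Finset.mem_sigma] at h
    simp [Finset.insert_erase h.2]

/-- The moment generating function (times the number of samples) of the number of marked elements
in a sample of size `n`, centred at its mean. -/
def sampleMGF (T : Finset ι) (n : ℕ) (l : ℝ) : ℝ :=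
  ∑ I ∈ Finset.powersetCard n (Finset.univ : Finset ι),
    Real.exp (l * ((I ∩ T).card - n * (T.card / Fintype.card ι)))

/-- A sample of size `n + 1` is a sample `I` of size `n` followed by a uniform draw from the `M = N
- n` remaining elements, where `N` is the population size. Given `I`, the draw is a Bernoulli
variable with parameter `t / M`, where `t` counts the remaining marked elements, and Hoeffding's
lemma controls its fluctuation. Adding its conditional mean multiplies the centred count by `(M - 1)
/ M`, which is why `l` is rescaled on the right. -/
theorem sampleMGF_succ_le (T : Finset ι) {n : ℕ} (hn : n < Fintype.card ι) (l : ℝ) :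
    ((n : ℝ) + 1) * sampleMGF T (n + 1) l ≤ (Fintype.card ι - n) * Real.exp (l ^ 2 / 8) *
      sampleMGF T n (l * ((Fintype.card ι - n - 1) / (Fintype.card ι - n))) := by
  have hM : (0 : ℝ) < Fintype.card ι - n := by
    have : (n : ℝ) < Fintype.card ι := by exact_mod_cast hn
    linarith
  have hN : (0 : ℝ) < Fintype.card ι := by
    have : (0 : ℝ) ≤ n := Nat.cast_nonneg n
    linarith
  rw [sampleMGF, sum_powersetCard_succ, sampleMGF, Finset.mul_sum]
  refine Finset.sum_le_sum fun I hI => ?_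
  have hIn : I.card = n := (Finset.mem_powersetCard.mp hI).2
  have hcompl : (Iᶜ.card : ℝ) = Fintype.card ι - n := by
    rw [Finset.card_compl, Nat.cast_sub (by omega), hIn]
  set t : ℝ := ((Iᶜ ∩ T).card : ℝ) with ht
  have hTcard : (T.card : ℝ) = (I ∩ T).card + t := by
    rw [ht]
    have := Finset.card_inter_add_card_sdiff T I
    rw [Finset.inter_comm T I, Finset.sdiff_eq_inter_compl, Finset.inter_comm T] at this
    exact_mod_cast this.symm
  have htM : t ≤ Fintype.card ι - n := by
    rw [← hcompl, ht]
    exact_mod_cast Finset.card_le_card Finset.inter_subset_left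
  set M : ℝ := Fintype.card ι - n with hMdef
  set S : ℝ := ((I ∩ T).card : ℝ) with hS
  set c : ℝ := ((n : ℝ) + 1) * (T.card / Fintype.card ι) with hc
  have hterm : ∀ i ∈ Iᶜ, Real.exp (l * (((insert i I ∩ T).card : ℝ)
      - ((n + 1 : ℕ) : ℝ) * (T.card / Fintype.card ι)))
      = Real.exp (l * (S - c)) * (if i ∈ T then Real.exp l else 1) := by
    intro i hi
    rw [Finset.mem_compl] at hi
    by_cases hiT : i ∈ T
    · rw [Finset.insert_inter_of_mem hiT, Finset.card_insert_of_notMem (by simp [hi]), if_pos hiT,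
        ← Real.exp_add]
      congr 1; push_cast; ring
    · rw [Finset.insert_inter_of_notMem hiT, if_neg hiT, mul_one]
      congr 1; push_cast; ring
  rw [Finset.sum_congr rfl hterm, ← Finset.mul_sum, Finset.sum_ite, Finset.sum_const,
    Finset.sum_const, Finset.filter_mem_eq_inter, nsmul_eq_mul, nsmul_eq_mul, ← ht]
  have hnot : ((Iᶜ.filter fun i => i ∉ T).card : ℝ) = M - t := by
    have := Finset.card_filter_add_card_filter_not (s := Iᶜ) (fun i => i ∈ T)
    rw [Finset.filter_mem_eq_inter] at this
    have h2 : ((Iᶜ ∩ T).card : ℝ) + ((Iᶜ.filter fun i => i ∉ T).card : ℝ) = Iᶜ.card := by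
      exact_mod_cast this
    linarith
  rw [hnot]
  have hB := bernoulli_mgf_le (p := t / M) (by positivity) ((div_le_one hM).mpr htM) l
  have hB2 : t * Real.exp l + (M - t) * 1 ≤ M * (Real.exp (l * (t / M)) * Real.exp (l ^ 2 / 8)) := by
    have e : t * Real.exp l + (M - t) * 1 = M * (Real.exp (l * (t / M)) *
        (t / M * Real.exp (l * (1 - t / M)) + (1 - t / M) * Real.exp (-(l * (t / M))))) := by
      have e1 : Real.exp l = Real.exp (l * (t / M)) * Real.exp (l * (1 - t / M)) := by
        rw [← Real.exp_add]; congr 1; ring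
      have e2 : Real.exp (l * (t / M)) * Real.exp (-(l * (t / M))) = 1 := by
        rw [← Real.exp_add]; simp
      have e3 : M * (t / M) = t := by field_simp
      calc t * Real.exp l + (M - t) * 1
          = (M * (t / M)) * (Real.exp (l * (t / M)) * Real.exp (l * (1 - t / M)))
            + (M - M * (t / M)) * (Real.exp (l * (t / M)) * Real.exp (-(l * (t / M)))) := by
              rw [e2, e3, ← e1]
        _ = _ := by ring
    rw [e]; gcongr
  refine (mul_le_mul_of_nonneg_left hB2 (Real.exp_pos _).le).trans (le_of_eq ?_)
  have e4 : Real.exp (l * ((M - 1) / M) * (S - n * (T.card / Fintype.card ι)))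
      = Real.exp (l * (S - c)) * Real.exp (l * (t / M)) := by
    rw [← Real.exp_add]
    congr 1
    have hNM : (Fintype.card ι : ℝ) = M + n := by rw [hMdef]; ring
    have hNM' : M + (n : ℝ) ≠ 0 := by rw [← hNM]; exact hN.ne'
    rw [hc, hTcard, hNM]
    field_simp
    ring
  rw [e4]; ring

/-- Iterating the one-draw estimate gives a sum of squared contraction factors; the closed form `n
(N - n + 1) / N`, with `N` the population size, dominates it. The induction is for all `l` at once
because each draw rescales `l`. -/
theorem sampleMGF_le (T : Finset ι) (n : ℕ) (hn : n ≤ Fintype.card ι)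
    (l : ℝ) : sampleMGF T n l ≤ (Fintype.card ι).choose n *
      Real.exp (l ^ 2 / 8 * (n * (Fintype.card ι - n + 1) / Fintype.card ι)) := by
  induction n generalizing l with
  | zero => simp [sampleMGF]
  | succ n ih =>
    have hlt : n < Fintype.card ι := hn
    have h1 := sampleMGF_succ_le T hlt l
    have h2 := ih hlt.le (l * ((Fintype.card ι - n - 1) / (Fintype.card ι - n)))
    obtain ⟨a, ha⟩ := Nat.exists_eq_add_of_lt hlt
    have hch : ((Fintype.card ι).choose (n + 1) : ℝ) * (n + 1)
        = (Fintype.card ι).choose n * (Fintype.card ι - n) := by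
      have := Nat.choose_succ_right_eq (Fintype.card ι) n
      rw [← Nat.cast_sub hlt.le]
      exact_mod_cast this
    have hN' : (Fintype.card ι : ℝ) = n + a + 1 := by rw [ha]; push_cast; ring
    have hpos : (0 : ℝ) < n + 1 := by positivity
    have hM : (0 : ℝ) ≤ Fintype.card ι - n := by rw [hN']; linarith [Nat.cast_nonneg (α := ℝ) a]
    refine le_of_mul_le_mul_left (h1.trans ?_) hpos
    calc _ ≤ (Fintype.card ι - n) * Real.exp (l ^ 2 / 8) * ((Fintype.card ι).choose n *
          Real.exp ((l * ((Fintype.card ι - n - 1) / (Fintype.card ι - n))) ^ 2 / 8 *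
            (n * (Fintype.card ι - n + 1) / Fintype.card ι))) := by gcongr
      _ = ((n : ℝ) + 1) * ((Fintype.card ι).choose (n + 1) * Real.exp (l ^ 2 / 8 +
          (l * ((Fintype.card ι - n - 1) / (Fintype.card ι - n))) ^ 2 / 8 *
            (n * (Fintype.card ι - n + 1) / Fintype.card ι))) := by
        rw [Real.exp_add]
        linear_combination (-Real.exp (l ^ 2 / 8) * Real.exp
          ((l * ((Fintype.card ι - n - 1) / (Fintype.card ι - n))) ^ 2 / 8 *
            (n * (Fintype.card ι - n + 1) / Fintype.card ι))) * hch
      _ ≤ _ := by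
        gcongr
        -- With `a = N - n - 1`, the right side exceeds the left by `n a / ((a + 1)² (n + a + 1))`.
        have key : 1 + ((Fintype.card ι - n - 1 : ℝ) / (Fintype.card ι - n)) ^ 2 *
            (n * (Fintype.card ι - n + 1) / Fintype.card ι)
            ≤ ((n + 1 : ℕ) : ℝ) * (Fintype.card ι - (n + 1 : ℕ) + 1) / Fintype.card ι := by
          rw [hN']
          push_cast
          have e1 : (n : ℝ) + a + 1 - n - 1 = a := by ring
          have e2 : (n : ℝ) + a + 1 - n = a + 1 := by ring
          have e3 : (n : ℝ) + a + 1 - (n + 1) + 1 = a + 1 := by ring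
          rw [e1, e2, e3, ← sub_nonneg]
          have : ((n : ℝ) + 1) * (a + 1) / (n + a + 1)
              - (1 + ((a : ℝ) / (a + 1)) ^ 2 * (n * (a + 1 + 1) / (n + a + 1)))
              = n * a / ((a + 1) ^ 2 * (n + a + 1)) := by
            field_simp
            ring
          rw [this]; positivity
        calc _ = l ^ 2 / 8 * (1 + ((Fintype.card ι - n - 1 : ℝ) / (Fintype.card ι - n)) ^ 2 *
              (n * (Fintype.card ι - n + 1) / Fintype.card ι)) := by ring
          _ ≤ _ := by gcongr

/-- Serfling's inequality: among the samples of `s` out of `s + k` elements, few have a density of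
marked elements that exceeds the density outside of the sample by `ν`. -/
theorem card_sample_le (s k : ℕ) (hι : Fintype.card ι = s + k) (hpos : 0 < s + k)
    (T : Finset ι) (δ ν : ℝ) (hν : 0 < ν) :
    (((Finset.powersetCard s (Finset.univ : Finset ι)).filter fun I =>
        (s : ℝ) * (δ + ν) ≤ (I ∩ T).card ∧ ((T \ I).card : ℝ) ≤ k * δ).card : ℝ)
      ≤ (s + k).choose s * smoothingParam s k ν ^ 2 := by
  -- The Chernoff exponent `l d - l² v / 8`, with `d = s k ν / (s + k)` and `v = s (k + 1) / (s +
  -- k)`, is largest at `l = 4 d / v`. The maximum is twice the exponent in `smoothingParam`, hence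
  -- the square in the bound.
  set l : ℝ := 4 * k * ν / (k + 1) with hl
  have hl0 : 0 ≤ l := by positivity
  have hm : (0 : ℝ) < s + k := by exact_mod_cast hpos
  have hmgf := sampleMGF_le T s (by omega) l
  have hι' : (Fintype.card ι : ℝ) = s + k := by rw [hι]; push_cast; ring
  have h1 : (((Finset.powersetCard s (Finset.univ : Finset ι)).filter fun I =>
        (s : ℝ) * (δ + ν) ≤ (I ∩ T).card ∧ ((T \ I).card : ℝ) ≤ k * δ).card : ℝ)
        * Real.exp (l * (s * k * ν / (s + k))) ≤ sampleMGF T s l := by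
    rw [sampleMGF, ← nsmul_eq_mul, ← Finset.sum_const]
    refine (Finset.sum_le_sum fun I hI => ?_).trans
      (Finset.sum_le_sum_of_subset_of_nonneg (Finset.filter_subset _ _)
        fun _ _ _ => (Real.exp_pos _).le)
    obtain ⟨-, h2, h3⟩ := Finset.mem_filter.mp hI
    have h4 : (T.card : ℝ) = (I ∩ T).card + (T \ I).card := by
      have := Finset.card_inter_add_card_sdiff T I
      rw [Finset.inter_comm] at this
      exact_mod_cast this.symm
    refine Real.exp_le_exp.mpr (mul_le_mul_of_nonneg_left ?_ hl0)
    rw [hι', h4, div_le_iff₀ hm]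
    -- Multiplied by `s + k`, the deviation from the mean compares the counts inside and outside the
    -- sample; the two assumptions bound it below by `s k ν`.
    have : (((I ∩ T).card : ℝ) - s * ((((I ∩ T).card : ℝ) + (T \ I).card) / (s + k))) * (s + k)
        = k * (I ∩ T).card - s * (T \ I).card := by
      field_simp; ring
    rw [this]
    nlinarith [mul_le_mul_of_nonneg_left h2 (Nat.cast_nonneg (α := ℝ) k),
      mul_le_mul_of_nonneg_left h3 (Nat.cast_nonneg (α := ℝ) s)]
  refine le_of_mul_le_mul_right ((h1.trans hmgf).trans (le_of_eq ?_))
    (Real.exp_pos (l * (s * k * ν / (s + k))))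
  rw [hι', hι, smoothingParam, ← Real.exp_nat_mul, mul_assoc, ← Real.exp_add]
  congr 2
  rw [hl]
  push_cast
  field_simp
  ring

end Sampling

/-! ### The volume of Hamming balls -/

theorem prod_ite_bit (n : ℕ) (x : Bits n) (p q : ℝ) :
    ∏ i, (if x i then p else q) = p ^ hammingWeight x * q ^ (n - hammingWeight x) := by
  rw [Finset.prod_ite, Finset.prod_const, Finset.prod_const, hammingWeight]
  congr 2
  have := Finset.card_filter_add_card_filter_not (s := (Finset.univ : Finset (Fin n)))
      (fun i => x i = true)
  simp only [Finset.card_univ, Fintype.card_fin] at this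
  omega

theorem hammingWeight_le {n : ℕ} (x : Bits n) : hammingWeight x ≤ n :=
  (Finset.card_filter_le _ _).trans (by simp)

/-- Under independent bits of bias `r`, each string of the ball has probability at least `2^(-n
h(r))`: since `r ≤ 1 - r`, the probability decreases with the weight. These probabilities sum to at
most one. -/
theorem card_hammingBall_le (n : ℕ) {r : ℝ} (hr : 0 < r) (hr2 : r ≤ 1 / 2) :
    ((Finset.univ.filter fun x : Bits n => (hammingWeight x : ℝ) ≤ n * r).card : ℝ)
      ≤ 2 ^ (n * binEnt r) := by
  have hq : 0 < 1 - r := by linarith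
  have hsum : ∑ x : Bits n, r ^ hammingWeight x * (1 - r) ^ (n - hammingWeight x) = 1 := by
    have := Fintype.sum_pow (fun b : Bool => if b then r else 1 - r) n
    simp only [prod_ite_bit] at this
    rw [← this]; simp
  have hterm : ∀ x : Bits n, (hammingWeight x : ℝ) ≤ n * r →
      (2 : ℝ) ^ (-(n * binEnt r)) ≤ r ^ hammingWeight x * (1 - r) ^ (n - hammingWeight x) := by
    intro x hx
    have e : (r ^ hammingWeight x * (1 - r) ^ (n - hammingWeight x) : ℝ)
        = 2 ^ (hammingWeight x * Real.logb 2 r + (n - hammingWeight x) * Real.logb 2 (1 - r)) := by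
      rw [Real.rpow_add two_pos, mul_comm _ (Real.logb 2 r), mul_comm _ (Real.logb 2 (1 - r)),
        Real.rpow_mul two_pos.le, Real.rpow_mul two_pos.le, Real.rpow_logb two_pos (by simp) hr,
        Real.rpow_logb two_pos (by simp) hq, ← Nat.cast_sub (hammingWeight_le x),
        Real.rpow_natCast, Real.rpow_natCast]
    rw [e]
    refine Real.rpow_le_rpow_of_exponent_le one_le_two ?_
    have hlog : Real.logb 2 r ≤ Real.logb 2 (1 - r) :=
      Real.logb_le_logb_of_le one_lt_two hr (by linarith)
    rw [binEnt]
    nlinarith [mul_nonneg (sub_nonneg.mpr hx) (sub_nonneg.mpr hlog)]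
  have hle : ((Finset.univ.filter fun x : Bits n => (hammingWeight x : ℝ) ≤ n * r).card : ℝ)
      * 2 ^ (-(n * binEnt r)) ≤ 1 := by
    rw [← hsum, ← nsmul_eq_mul, ← Finset.sum_const]
    refine (Finset.sum_le_sum fun x hx => hterm x (Finset.mem_filter.mp hx).2).trans
      (Finset.sum_le_sum_of_subset_of_nonneg (Finset.filter_subset _ _) fun _ _ _ => by positivity)
  rwa [Real.rpow_neg two_pos.le, mul_inv_le_iff₀ (by positivity), one_mul] at hle

/-! ### Max-entropy of states with small conditional support -/

section Entropy

variable {A B C : Type*} [Fintype A] [Fintype B] [Fintype C]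

theorem posSemidef_pureState (v : A → ℂ) : (pureState v).PosSemidef :=
  Matrix.posSemidef_vecMulVec_self_star v

theorem dotProduct_pureState_mulVec (v x : A → ℂ) :
    star x ⬝ᵥ (pureState v).mulVec x = ((‖star x ⬝ᵥ v‖ ^ 2 : ℝ) : ℂ) := by
  have h : star v ⬝ᵥ x = star (star x ⬝ᵥ v) := Matrix.star_dotProduct v x
  rw [pureState, Matrix.vecMulVec_mulVec, dotProduct_smul, ← Complex.normSq_eq_norm_sq,
    ← Complex.mul_conj, h, op_smul_eq_mul, starRingEnd_apply]

/-- The pinching inequality for a sum of vectors. -/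
theorem pureState_sum_le {ι : Type*} (S : Finset ι) (u : ι → A → ℂ) :
    pureState (∑ i ∈ S, u i) ≤ (S.card : ℝ) • ∑ i ∈ S, pureState (u i) := by
  rw [Matrix.le_iff]
  refine .of_dotProduct_mulVec_nonneg ?_ fun x => ?_
  · refine Matrix.IsHermitian.sub ?_ (posSemidef_pureState _).1
    exact ((Matrix.posSemidef_sum _ fun i _ => posSemidef_pureState (u i)).smul
      (Nat.cast_nonneg (α := ℝ) _)).1
  · rw [Matrix.sub_mulVec, dotProduct_sub, Matrix.smul_mulVec, dotProduct_smul, Matrix.sum_mulVec,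
      dotProduct_sum, dotProduct_pureState_mulVec, dotProduct_sum]
    simp only [dotProduct_pureState_mulVec]
    rw [← Complex.ofReal_sum, Complex.real_smul, ← Complex.ofReal_mul, ← Complex.ofReal_sub,
      Complex.zero_le_real, sub_nonneg]
    calc ‖∑ i ∈ S, star x ⬝ᵥ u i‖ ^ 2 ≤ (∑ i ∈ S, ‖star x ⬝ᵥ u i‖) ^ 2 := by
          gcongr; exact norm_sum_le _ _
      _ ≤ _ := sq_sum_le_card_mul_sum_sq

variable [DecidableEq A] [DecidableEq C]

/-- The vector `|a'⟩ ⊗ |ψ_{ab}⟩`. -/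
def blockVec (ψ : A × B × C → ℂ) (a' a : A) (b : B) : A × C → ℂ :=
  fun p => if p.1 = a' then ψ (a, b, p.2) else 0

/-- The reduced operator on the last system of a tripartite pure state. -/
def marginalLast (ψ : A × B × C → ℂ) : Matrix C C ℂ :=
  ∑ a, ∑ b, pureState fun c => ψ (a, b, c)

-- Expanding the identity on `A` yields all pairs `a'`, `a`; the upper bound on `ρ_AC` needs only
-- the diagonal ones `a' = a`.
omit [Fintype C] [DecidableEq C] in
theorem one_kronecker_marginalLast (ψ : A × B × C → ℂ) :
    (1 : Matrix A A ℂ) ⊗ₖ marginalLast ψ = ∑ b, ∑ a', ∑ a, pureState (blockVec ψ a' a b) := by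
  ext p q
  simp only [marginalLast, Matrix.kroneckerMap_apply, Matrix.sum_apply, pureState,
    Matrix.vecMulVec_apply, blockVec, Pi.star_apply, Matrix.one_apply]
  rw [Finset.sum_comm, Finset.mul_sum]
  refine Finset.sum_congr rfl fun b _ => ?_
  rw [Finset.sum_comm, Finset.mul_sum]
  refine Finset.sum_congr rfl fun a _ => ?_
  rw [Finset.sum_eq_single p.1 (fun a' _ h => by simp [Ne.symm h]) (by simp)]
  by_cases h : p.1 = q.1
  · simp [h]
  · simp [h, Ne.symm h]

omit [Fintype A] [Fintype C] [DecidableEq C] in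
theorem traceOutMid_pureState (ψ : A × B × C → ℂ) (S : B → Finset A)
    (hψ : ∀ a b c, a ∉ S b → ψ (a, b, c) = 0) :
    traceOutMid (pureState ψ) = ∑ b, pureState (∑ a ∈ S b, blockVec ψ a a b) := by
  have h : ∀ b (p : A × C), (∑ a ∈ S b, blockVec ψ a a b) p = ψ (p.1, b, p.2) := fun b p => by
    simp only [Finset.sum_apply, blockVec]
    rw [Finset.sum_ite_eq]
    split_ifs with hp
    · rfl
    · exact (hψ _ _ _ hp).symm
  ext p q
  simp only [traceOutMid, Matrix.of_apply, Matrix.sum_apply, pureState, Matrix.vecMulVec_apply, h,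
    Pi.star_apply]

/-- For each `b`, the unnormalized conditional vector is a sum of at most `N` blocks `|a⟩ ⊗
|ψ_{ab}⟩`, so pinching costs a factor `N`. The remaining blocks of `1 ⊗ ρ_C` are positive and only
help. -/
theorem traceOutMid_le (ψ : A × B × C → ℂ) (S : B → Finset A)
    (hψ : ∀ a b c, a ∉ S b → ψ (a, b, c) = 0) {N : ℝ} (hS : ∀ b, ((S b).card : ℝ) ≤ N) :
    traceOutMid (pureState ψ) ≤ N • ((1 : Matrix A A ℂ) ⊗ₖ marginalLast ψ) := by
  rw [traceOutMid_pureState ψ S hψ, one_kronecker_marginalLast, Finset.smul_sum]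
  refine Finset.sum_le_sum fun b _ => (pureState_sum_le _ _).trans ?_
  have hnn : ∀ a' a, 0 ≤ pureState (blockVec ψ a' a b) := fun a' a =>
    (posSemidef_pureState _).nonneg
  have hnonneg : (0 : Matrix (A × C) (A × C) ℂ) ≤ ∑ a ∈ S b, pureState (blockVec ψ a a b) :=
    Finset.sum_nonneg fun a _ => hnn a a
  refine (smul_le_smul_of_nonneg_right (hS b) hnonneg).trans
    (smul_le_smul_of_nonneg_left ?_ ((Nat.cast_nonneg _).trans (hS b)))
  refine (Finset.sum_le_sum_of_subset_of_nonneg (Finset.subset_univ _)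
    fun a _ _ => hnn a a).trans (Finset.sum_le_sum fun a' _ => ?_)
  exact Finset.single_le_sum (f := fun a => pureState (blockVec ψ a' a b))
    (fun a _ => hnn a' a) (Finset.mem_univ a')

variable [DecidableEq B]

omit [Fintype A] [Fintype B] [DecidableEq A] [DecidableEq C] [DecidableEq B] in
theorem IsPurification.sum_normSq {ψ : A × B × C → ℂ} {ρ : Matrix (A × B) (A × B) ℂ}
    (h : IsPurification ψ ρ) (a : A) (b : B) :
    ρ (a, b) (a, b) = ((∑ c, ‖ψ (a, b, c)‖ ^ 2 : ℝ) : ℂ) := by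
  rw [← show traceOutLast (pureState ψ) = ρ from h]
  simp only [traceOutLast, pureState, Matrix.of_apply, Matrix.vecMulVec_apply, Pi.star_apply,
    Complex.ofReal_sum, ← Complex.normSq_eq_norm_sq, ← Complex.mul_conj, starRingEnd_apply]

theorem IsPurification.trace_marginalLast {ψ : A × B × C → ℂ} {ρ : Matrix (A × B) (A × B) ℂ}
    (h : IsPurification ψ ρ) : (marginalLast ψ).trace = ρ.trace := by
  simp only [marginalLast, Matrix.trace_sum]
  rw [Matrix.trace, Fintype.sum_prod_type]
  refine Finset.sum_congr rfl fun a _ => Finset.sum_congr rfl fun b _ => ?_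
  rw [Matrix.diag_apply, h.sum_normSq]
  simp only [pureState, Matrix.trace, Matrix.diag_apply, Matrix.vecMulVec_apply, Pi.star_apply,
    Complex.ofReal_sum, ← Complex.normSq_eq_norm_sq, ← Complex.mul_conj, starRingEnd_apply]

/-- The marginal on the purifying system serves as the state in the definition of the min-entropy.
Only the diagonal of `ρ` matters: a vanishing diagonal entry at `(a, b)` forces the whole vector `ψ
(a, b, ·)` to vanish. -/
theorem condMaxEntropy_le (ρ : Matrix (A × B) (A × B) ℂ) (htr : ρ.trace.re ≤ 1) (S : B → Finset A)
    (h0 : ∀ a b, a ∉ S b → ρ (a, b) (a, b) = 0) (r : ℝ) (hS : ∀ b, ((S b).card : ℝ) ≤ 2 ^ r) :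
    condMaxEntropy ρ ≤ (r : EReal) := by
  refine iSup_le fun n => iSup_le fun ψ => iSup_le fun hψ => ?_
  rw [EReal.neg_le]
  have hzero : ∀ a b c, a ∉ S b → ψ (a, b, c) = 0 := fun a b c ha => by
    have h1 := (hψ.sum_normSq a b).symm.trans (h0 a b ha)
    rw [Complex.ofReal_eq_zero, Finset.sum_eq_zero_iff_of_nonneg fun _ _ => by positivity] at h1
    simpa using h1 c (Finset.mem_univ c)
  set τ := marginalLast ψ with hτ
  have hτpos : τ.PosSemidef := Matrix.posSemidef_sum _ fun a _ =>
    Matrix.posSemidef_sum _ fun b _ => posSemidef_pureState _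
  have hτtr : τ.trace = (τ.trace.re : ℂ) :=
    Complex.ext rfl (by simpa using (Complex.le_def.mp hτpos.trace_nonneg).2.symm)
  have hτ1 : 0 ≤ 1 - τ.trace.re := by rw [hτ, hψ.trace_marginalLast]; linarith
  -- The marginal may have trace below one. The missing weight is put on an arbitrary pure state,
  -- which exists because the purifying system is nonzero and which only enlarges the upper bound.
  let ω : Matrix (Fin (n + 1)) (Fin (n + 1)) ℂ := Matrix.diagonal (Pi.single 0 1)
  have hω : ω.PosSemidef := .diagonal fun i => by
    rcases eq_or_ne i 0 with rfl | hi
    · simp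
    · simp [hi]
  have hωtr : ω.trace = 1 := by simp [ω, Matrix.trace_diagonal]
  have hωs : ((1 - τ.trace.re) • ω).PosSemidef := hω.smul hτ1
  refine le_sSup ⟨-r, by simp, τ + (1 - τ.trace.re) • ω, ⟨hτpos.add hωs, ?_⟩, ?_⟩
  · rw [Matrix.trace_add, Matrix.trace_smul, hωtr, hτtr]
    simp
  · rw [← Matrix.le_iff, neg_neg]
    refine (traceOutMid_le ψ S hzero hS).trans (smul_le_smul_of_nonneg_left ?_ (by positivity))
    rw [Matrix.kronecker_add, le_add_iff_nonneg_right]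
    exact (Matrix.PosSemidef.one.kronecker hωs).nonneg

end Entropy

/-! ### Fidelity of classical states -/

section Classical

variable {A : Type*} [Fintype A] [DecidableEq A]

/-- The diagonal operator with given real entries. -/
def classicalState (p : A → ℝ) : Matrix A A ℂ := Matrix.diagonal fun a => (p a : ℂ)

omit [Fintype A] in
theorem posSemidef_classicalState {p : A → ℝ} (hp : ∀ a, 0 ≤ p a) : (classicalState p).PosSemidef :=
  .diagonal fun a => by simpa using hp a

theorem trace_classicalState (p : A → ℝ) : (classicalState p).trace.re = ∑ a, p a := by
  simp [classicalState, Matrix.trace_diagonal]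

theorem sqrt_classicalState {p : A → ℝ} (hp : ∀ a, 0 ≤ p a) :
    CFC.sqrt (classicalState p) = classicalState fun a => √(p a) := by
  refine CFC.sqrt_unique ?_ (posSemidef_classicalState fun a => Real.sqrt_nonneg _).nonneg
  simp only [classicalState, Matrix.diagonal_mul_diagonal, ← Complex.ofReal_mul,
    Real.mul_self_sqrt (hp _)]

theorem genFidelity_classicalState {p q : A → ℝ} (hp : ∀ a, 0 ≤ p a) (hq : ∀ a, 0 ≤ q a) :
    genFidelity (classicalState p) (classicalState q)
      = (∑ a, √(p a * q a) + √(1 - ∑ a, p a) * √(1 - ∑ a, q a)) ^ 2 := by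
  have h : CFC.sqrt (classicalState p) * classicalState q * CFC.sqrt (classicalState p)
      = classicalState fun a => p a * q a := by
    rw [sqrt_classicalState hp]
    simp only [classicalState, Matrix.diagonal_mul_diagonal, ← Complex.ofReal_mul]
    congr 1; ext a; congr 1
    rw [mul_right_comm, Real.mul_self_sqrt (hp a)]
  rw [genFidelity, h, sqrt_classicalState fun a => mul_nonneg (hp a) (hq a), trace_classicalState,
    trace_classicalState, trace_classicalState]

/-- Conditioning a subnormalized distribution on an event of its normalized completion that has
probability `1 - e` moves it by `√e` in purified distance. -/
theorem purifiedDist_restrict {p : A → ℝ} (hp : ∀ a, 0 ≤ p a) (hp1 : ∑ a, p a ≤ 1)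
    (G : Finset A) (hG : ∑ a ∈ Gᶜ, p a < 1) :
    purifiedDist (classicalState fun a => if a ∈ G then p a / (1 - ∑ a ∈ Gᶜ, p a) else 0)
      (classicalState p) = √(∑ a ∈ Gᶜ, p a) := by
  set e := ∑ a ∈ Gᶜ, p a with he
  have hsplit : ∑ a, p a = ∑ a ∈ G, p a + e := (Finset.sum_add_sum_compl G p).symm
  have h1 : 0 < 1 - e := by linarith
  have hsum : ∑ a, (if a ∈ G then p a / (1 - e) else 0) = (∑ a ∈ G, p a) / (1 - e) := by
    rw [Finset.sum_ite_mem, Finset.univ_inter, Finset.sum_div]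
  have hsqrt : ∑ a, √((if a ∈ G then p a / (1 - e) else 0) * p a) = (∑ a ∈ G, p a) / √(1 - e) := by
    have hterm : ∀ a, √((if a ∈ G then p a / (1 - e) else 0) * p a)
        = if a ∈ G then p a / √(1 - e) else 0 := fun a => by
      split_ifs
      · rw [div_mul_eq_mul_div, Real.sqrt_div (mul_nonneg (hp a) (hp a)), Real.sqrt_mul_self (hp a)]
      · simp
    rw [Finset.sum_congr rfl fun a _ => hterm a, Finset.sum_ite_mem, Finset.univ_inter,
      Finset.sum_div]
  rw [purifiedDist, genFidelity_classicalState _ hp, hsum, hsqrt]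
  -- The missing mass is rescaled by the same factor `1 / (1 - e)`, so the two terms of the fidelity
  -- add up to `(1 - e) / √(1 - e)`. Without rescaling the distance could be as large as `√(2 e -
  -- e²)`.
  · have h2 : 1 - (∑ a ∈ G, p a) / (1 - e) = (1 - ∑ a, p a) / (1 - e) := by
      rw [hsplit]; field_simp; ring
    have h3 : 0 ≤ 1 - ∑ a, p a := by linarith
    rw [h2, Real.sqrt_div h3, div_mul_eq_mul_div, Real.mul_self_sqrt h3, ← add_div]
    have h4 : ∑ a ∈ G, p a + (1 - ∑ a, p a) = √(1 - e) * √(1 - e) := by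
      rw [Real.mul_self_sqrt h1.le, hsplit]; ring
    rw [h4, mul_div_assoc, div_self (Real.sqrt_ne_zero'.mpr h1), mul_one, Real.sq_sqrt h1.le]
    congr 1; ring
  · intro a
    split_ifs
    · exact div_nonneg (hp a) h1.le
    · exact le_rfl

end Classical

/-! ### Product operators on qubits -/

theorem qubitMeas_isHermitian (b x : Bool) : (qubitMeas b x).IsHermitian := by
  have h : hadamard.conjTranspose = hadamard := by
    ext i j
    cases i <;> cases j <;> simp [hadamard]
  unfold Matrix.IsHermitian qubitMeas
  split_ifs
  · simp [h, Matrix.conjTranspose_mul, Matrix.mul_assoc]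
  · simp

theorem hadamard_mul_self : hadamard * hadamard = 1 := by
  have h : ((√2 : ℝ) : ℂ)⁻¹ * ((√2 : ℝ) : ℂ)⁻¹ = 2⁻¹ := by
    rw [← mul_inv, ← Complex.ofReal_mul, Real.mul_self_sqrt zero_le_two]; simp
  ext i j
  cases i <;> cases j <;> simp [hadamard, Matrix.mul_apply, h] <;> norm_num

theorem qubitMeas_mul_self (b x : Bool) : qubitMeas b x * qubitMeas b x = qubitMeas b x := by
  unfold qubitMeas
  split_ifs
  · calc _ = hadamard * Matrix.single x x 1 * (hadamard * hadamard) * Matrix.single x x 1 * hadamard :=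
          by simp only [Matrix.mul_assoc]
      _ = _ := by rw [hadamard_mul_self]; simp [Matrix.mul_assoc]
  · simp

theorem sum_qubitMeas (b : Bool) : ∑ x, qubitMeas b x = 1 := by
  have h : ∑ x : Bool, Matrix.single x x (1 : ℂ) = 1 := Matrix.sum_single_one
  cases b
  · simpa [qubitMeas] using h
  · simp only [qubitMeas, if_true]
    rw [← Finset.sum_mul, ← Finset.mul_sum, h, mul_one, hadamard_mul_self]

/-- The product operator `⊗_i Q i`. -/
def tensorOp {n : ℕ} (Q : Fin n → Matrix Bool Bool ℂ) : Matrix (Bits n) (Bits n) ℂ :=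
  Matrix.of fun f g => ∏ i, Q i (f i) (g i)

theorem tensorOp_mul {n : ℕ} (P Q : Fin n → Matrix Bool Bool ℂ) :
    tensorOp P * tensorOp Q = tensorOp fun i => P i * Q i := by
  ext f g
  simp only [tensorOp, Matrix.mul_apply, Matrix.of_apply, ← Finset.prod_mul_distrib]
  rw [Finset.prod_univ_sum, Fintype.piFinset_univ]

theorem tensorOp_isHermitian {n : ℕ} {Q : Fin n → Matrix Bool Bool ℂ}
    (h : ∀ i, (Q i).IsHermitian) : (tensorOp Q).IsHermitian := by
  ext f g
  simp only [tensorOp, Matrix.conjTranspose_apply, Matrix.of_apply, star_prod, (h _).apply]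

theorem tensorOp_one (n : ℕ) : tensorOp (fun _ : Fin n => 1) = 1 := by
  ext f g
  simp only [tensorOp, Matrix.of_apply, Matrix.one_apply]
  rw [Finset.prod_ite_zero]
  simp [funext_iff]

theorem sum_tensorOp {n : ℕ} (Q : Bool → Matrix Bool Bool ℂ) :
    ∑ a : Bits n, tensorOp (fun i => Q (a i)) = tensorOp fun _ => ∑ x, Q x := by
  ext f g
  simp only [tensorOp, Matrix.sum_apply, Matrix.of_apply]
  rw [Finset.prod_univ_sum, Fintype.piFinset_univ]

theorem sum_measOn {m l : ℕ} (e : Fin l ↪o Fin m) (b : Bool) : ∑ x, measOn e b x = 1 := by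
  ext f g
  simp only [measOn, Matrix.sum_apply, Matrix.of_apply]
  rw [← Finset.sum_mul]
  have h : ∑ x : Bits l, ∏ j, qubitMeas b (x j) (f (e j)) (g (e j))
      = ∏ j, (1 : Matrix Bool Bool ℂ) (f (e j)) (g (e j)) := by
    simp only [← sum_qubitMeas b, Matrix.sum_apply]
    rw [Finset.prod_univ_sum, Fintype.piFinset_univ]
  simp only [h, Matrix.one_apply]
  rw [Finset.prod_ite_zero, ite_zero_mul_ite_zero]
  simp only [Finset.prod_const_one, mul_one]
  refine if_congr ⟨fun h => funext fun i => ?_, fun h => by simp [h]⟩ rfl rfl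
  by_cases hi : i ∈ Set.range e
  · obtain ⟨j, rfl⟩ := hi
    exact h.1 j (Finset.mem_univ j)
  · exact h.2 i hi

/-! ### Splitting strings along the seed -/

section Seed

variable {s k : ℕ} (θ : BasisSeed s k)

theorem mem_range_posI (i : Fin (s + k)) : i ∈ Set.range (posI θ) ↔ θ.1 i = false := by
  rw [posI, Finset.range_orderEmbOfFin]; simp

theorem mem_range_posIbar (i : Fin (s + k)) : i ∈ Set.range (posIbar θ) ↔ θ.1 i = true :=
  (Set.ext_iff.mp (Finset.range_orderEmbOfFin _ θ.2) i).trans (by simp)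

theorem seed_posI (j : Fin s) : θ.1 (posI θ j) = false := (mem_range_posI θ _).mp ⟨j, rfl⟩

theorem seed_posIbar (j : Fin k) : θ.1 (posIbar θ j) = true := (mem_range_posIbar θ _).mp ⟨j, rfl⟩

/-- The partition of the positions given by the seed. -/
def seedEquiv : Fin s ⊕ Fin k ≃ Fin (s + k) :=
  Equiv.ofBijective (Sum.elim (posI θ) (posIbar θ)) <| by
    rw [Fintype.bijective_iff_injective_and_card]
    refine ⟨(posI θ).injective.sumElim (posIbar θ).injective fun i j h => ?_, by simp⟩
    have h1 := seed_posI θ i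
    rw [h, seed_posIbar] at h1
    exact absurd h1 (by simp)

/-- The family on all positions with given restrictions to `𝓘` and its complement. -/
def glue {α : Type*} (u : Fin s → α) (w : Fin k → α) : Fin (s + k) → α :=
  fun i => Sum.elim u w ((seedEquiv θ).symm i)

theorem glue_posI {α : Type*} (u : Fin s → α) (w : Fin k → α) (j : Fin s) :
    glue θ u w (posI θ j) = u j := by
  have h : posI θ j = seedEquiv θ (Sum.inl j) := rfl
  rw [glue, h, Equiv.symm_apply_apply, Sum.elim_inl]

theorem glue_posIbar {α : Type*} (u : Fin s → α) (w : Fin k → α) (j : Fin k) :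
    glue θ u w (posIbar θ j) = w j := by
  have h : posIbar θ j = seedEquiv θ (Sum.inr j) := rfl
  rw [glue, h, Equiv.symm_apply_apply, Sum.elim_inr]

theorem glue_comp {α β : Type*} (f : α → β) (u : Fin s → α) (w : Fin k → α) :
    glue θ (fun j => f (u j)) (fun j => f (w j)) = fun i => f (glue θ u w i) := by
  ext i
  simp only [glue]
  cases (seedEquiv θ).symm i <;> rfl

theorem prod_seed {M : Type*} [CommMonoid M] (F : Fin (s + k) → M) :
    ∏ i, F i = (∏ j, F (posI θ j)) * ∏ j, F (posIbar θ j) := by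
  rw [← Equiv.prod_comp (seedEquiv θ), Fintype.prod_sum_type]
  rfl

/-- Strings on all positions are pairs of strings on `𝓘` and on its complement. -/
def glueEquiv : Bits s × Bits k ≃ Bits (s + k) where
  toFun p := glue θ p.1 p.2
  invFun a := (fun j => a (posI θ j), fun j => a (posIbar θ j))
  left_inv p := by ext <;> simp [glue_posI, glue_posIbar]
  right_inv a := by
    ext i
    obtain ⟨j | j, rfl⟩ := (seedEquiv θ).surjective i
    · exact glue_posI θ _ _ j
    · exact glue_posIbar θ _ _ j

theorem measOn_mul_measOn (b : Bool) (z : Bits s) (v : Bits k) :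
    measOn (posI θ) b z * measOn (posIbar θ) true v
      = tensorOp (glue θ (fun j => qubitMeas b (z j)) fun j => qubitMeas true (v j)) := by
  ext f g
  rw [Matrix.mul_apply]
  -- The first factor is the identity off `𝓘` and the second is the identity on `𝓘`, so this is the
  -- only intermediate string that contributes to the matrix product.
  let h₀ : Bits (s + k) := fun i => if θ.1 i then f i else g i
  rw [Finset.sum_eq_single h₀]
  · rw [tensorOp, Matrix.of_apply, prod_seed θ]
    simp only [measOn, Matrix.of_apply, mem_range_posI, mem_range_posIbar, h₀, glue_posI,
      glue_posIbar, seed_posI, seed_posIbar, if_true, Bool.false_eq_true, if_false]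
    rw [if_pos fun i hi => by simp [hi], if_pos fun i hi => by simp [hi], mul_one, mul_one]
  · intro h _ hne
    obtain ⟨i, hi⟩ := Function.ne_iff.mp hne
    simp only [h₀] at hi
    simp only [measOn, Matrix.of_apply, mem_range_posI, mem_range_posIbar]
    cases hθ : θ.1 i
    · rw [if_neg (fun H : ∀ i, ¬ θ.1 i = true → h i = g i => hi (by simp [hθ, H i (by simp [hθ])]))]
      simp
    · rw [if_neg (fun H : ∀ i, ¬ θ.1 i = false → f i = h i =>
        hi (by simp [hθ, H i (by simp [hθ])]))]
      simp
  · simp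

end Seed

/-! ### Measurement statistics -/

section Statistics

variable {s k : ℕ}

theorem isHermitian_kronecker {A B : Type*} {P : Matrix A A ℂ} {Q : Matrix B B ℂ}
    (hP : P.IsHermitian) (hQ : Q.IsHermitian) : (P ⊗ₖ Q).IsHermitian := by
  rw [Matrix.IsHermitian, Matrix.conjTranspose_kronecker, hP.eq, hQ.eq]

theorem sum_kronecker {ι A B : Type*} (S : Finset ι) (P : ι → Matrix A A ℂ) (Q : Matrix B B ℂ) :
    ∑ i ∈ S, P i ⊗ₖ Q = (∑ i ∈ S, P i) ⊗ₖ Q := by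
  ext x y
  simp [Matrix.sum_apply, Finset.sum_mul]

theorem kronecker_sum {ι A B : Type*} (S : Finset ι) (P : Matrix A A ℂ) (Q : ι → Matrix B B ℂ) :
    ∑ i ∈ S, P ⊗ₖ Q i = P ⊗ₖ ∑ i ∈ S, Q i := by
  ext x y
  simp [Matrix.sum_apply, Finset.mul_sum]

theorem glue_qubitMeas (θ : BasisSeed s k) (b : Bool) (z : Bits s) (v : Bits k) (i : Fin (s + k)) :
    ∃ b' x', glue θ (fun j => qubitMeas b (z j)) (fun j => qubitMeas true (v j)) i
      = qubitMeas b' x' := by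
  simp only [glue]
  cases (seedEquiv θ).symm i with
  | inl j => exact ⟨b, z j, rfl⟩
  | inr j => exact ⟨true, v j, rfl⟩

theorem measOn_mul_isHermitian (θ : BasisSeed s k) (b : Bool) (z : Bits s) (v : Bits k) :
    (measOn (posI θ) b z * measOn (posIbar θ) true v).IsHermitian := by
  rw [measOn_mul_measOn]
  refine tensorOp_isHermitian fun i => ?_
  obtain ⟨b', x', h⟩ := glue_qubitMeas θ b z v i
  rw [h]; exact qubitMeas_isHermitian b' x'

theorem measOn_mul_mul_self (θ : BasisSeed s k) (b : Bool) (z : Bits s) (v : Bits k) :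
    (measOn (posI θ) b z * measOn (posIbar θ) true v)
      * (measOn (posI θ) b z * measOn (posIbar θ) true v)
      = measOn (posI θ) b z * measOn (posIbar θ) true v := by
  rw [measOn_mul_measOn, tensorOp_mul]
  congr 1
  ext1 i
  obtain ⟨b', x', h⟩ := glue_qubitMeas θ b z v i
  rw [h, qubitMeas_mul_self]

theorem totalMeas_isHermitian (b : Bool) (r : Registers s k) : (totalMeas b r).IsHermitian := by
  obtain ⟨v, w, z, y, θ⟩ := r
  exact isHermitian_kronecker (measOn_mul_isHermitian θ b z v)
    (isHermitian_kronecker (measOn_mul_isHermitian θ true y w) Matrix.isHermitian_one)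

theorem totalMeas_mul_self (b : Bool) (r : Registers s k) :
    totalMeas b r * totalMeas b r = totalMeas b r := by
  obtain ⟨v, w, z, y, θ⟩ := r
  simp only [totalMeas]
  rw [← Matrix.mul_kronecker_mul, ← Matrix.mul_kronecker_mul, measOn_mul_mul_self,
    measOn_mul_mul_self, mul_one]

/-- The probability of the outcomes in `r`, conditioned on the seed. -/
def outcomeProb (b : Bool) (ρ : Matrix (ABB' (s + k)) (ABB' (s + k)) ℂ) (r : Registers s k) : ℝ :=
  (totalMeas b r * ρ).trace.re

/-- The measurement is projective, so cyclicity of the trace removes one of the two operators. This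
makes outcome probabilities linear in the measurement operator, and they can be summed over
outcomes. -/
theorem trace_totalMeas (b : Bool) (ρ : Matrix (ABB' (s + k)) (ABB' (s + k)) ℂ)
    (r : Registers s k) :
    (totalMeas b r * ρ * (totalMeas b r).conjTranspose).trace = (totalMeas b r * ρ).trace := by
  rw [(totalMeas_isHermitian b r).eq, Matrix.trace_mul_comm, ← mul_assoc, totalMeas_mul_self]

theorem trace_totalMeas_eq (b : Bool) {ρ : Matrix (ABB' (s + k)) (ABB' (s + k)) ℂ}
    (hρ : ρ.PosSemidef) (r : Registers s k) :
    (totalMeas b r * ρ).trace = (outcomeProb b ρ r : ℂ) ∧ 0 ≤ outcomeProb b ρ r := by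
  have h := (hρ.mul_mul_conjTranspose_same (totalMeas b r)).trace_nonneg
  rw [trace_totalMeas, Complex.le_def] at h
  exact ⟨Complex.ext rfl (by simpa using h.2.symm), by simpa [outcomeProb] using h.1⟩

theorem postMeasState_eq (b : Bool) {ρ : Matrix (ABB' (s + k)) (ABB' (s + k)) ℂ}
    (hρ : ρ.PosSemidef) : postMeasState b ρ
      = Matrix.diagonal fun r => (((((s + k).choose k : ℝ))⁻¹ * outcomeProb b ρ r : ℝ) : ℂ) := by
  rw [postMeasState]
  congr 1
  ext1 r
  rw [trace_totalMeas, (trace_totalMeas_eq b hρ r).1]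
  push_cast; rfl

/-- Completeness of the measurement on `𝓘` of `A` eliminates its operator, and with it every
dependence on `b`. -/
theorem sum_outcomeProb (b : Bool) (ρ : Matrix (ABB' (s + k)) (ABB' (s + k)) ℂ)
    (v w : Bits k) (y : Bits s) (θ : BasisSeed s k) :
    ∑ z, outcomeProb b ρ (v, w, z, y, θ)
      = ((measOn (posIbar θ) true v ⊗ₖ ((measOn (posI θ) true y * measOn (posIbar θ) true w) ⊗ₖ
        (1 : Matrix (Bits (s + k)) _ ℂ))) * ρ).trace.re := by
  simp only [outcomeProb, totalMeas]
  rw [← Complex.re_sum, ← Matrix.trace_sum, ← Finset.sum_mul, sum_kronecker, ← Finset.sum_mul,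
    sum_measOn, one_mul]

theorem probComp_postMeasState (b b' : Bool) (δ : ℝ)
    {ρ : Matrix (ABB' (s + k)) (ABB' (s + k)) ℂ} (hρ : ρ.PosSemidef) :
    probComp δ (postMeasState b ρ) = probComp δ (postMeasState b' ρ) := by
  classical
  simp only [probComp, postMeasState_eq _ hρ, Matrix.diagonal_apply_eq, Complex.ofReal_re,
    Fintype.sum_prod_type]
  refine Finset.sum_congr rfl fun v _ => Finset.sum_congr rfl fun w _ => ?_
  split_ifs
  · have swap : ∀ f : Bits s → Bits s → BasisSeed s k → ℝ,
        ∑ z, ∑ y, ∑ θ, f z y θ = ∑ y, ∑ θ, ∑ z, f z y θ := fun f => by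
      rw [Finset.sum_comm]
      exact Finset.sum_congr rfl fun y _ => Finset.sum_comm
    rw [swap, swap]
    simp only [← Finset.mul_sum, sum_outcomeProb]
  · simp

/-- The joint distribution of the outcomes when all qubits of `A` and `B` are measured in the
Hadamard basis. -/
def jointProb {m : ℕ} (ρ : Matrix (ABB' m) (ABB' m) ℂ) (a b : Bits m) : ℝ :=
  (((tensorOp fun i => qubitMeas true (a i)) ⊗ₖ ((tensorOp fun i => qubitMeas true (b i)) ⊗ₖ
    (1 : Matrix (Bits m) _ ℂ))) * ρ).trace.re

/-- This is the reduction to classical sampling: on the right the seed occurs only in the way the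
outcome strings are cut. -/
theorem outcomeProb_true (ρ : Matrix (ABB' (s + k)) (ABB' (s + k)) ℂ)
    (v w : Bits k) (z y : Bits s) (θ : BasisSeed s k) :
    outcomeProb true ρ (v, w, z, y, θ) = jointProb ρ (glue θ z v) (glue θ y w) := by
  rw [outcomeProb, totalMeas, measOn_mul_measOn, measOn_mul_measOn, glue_comp, glue_comp, jointProb]

theorem sum_jointProb {m : ℕ} {ρ : Matrix (ABB' m) (ABB' m) ℂ} (hρ : ρ.trace = 1) :
    ∑ a, ∑ b, jointProb ρ a b = 1 := by
  simp only [jointProb, ← Complex.re_sum, ← Matrix.trace_sum, ← Finset.sum_mul, kronecker_sum,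
    sum_kronecker, sum_tensorOp, sum_qubitMeas, tensorOp_one, Matrix.one_kronecker_one, one_mul, hρ,
    Complex.one_re]

end Statistics

/-! ### The distribution of the outcomes `Z, Y` on the event that the test is passed -/

section Comparison

variable {s k : ℕ}

open Classical in
/-- The joint probability of the outcomes `z, y` and the event that the test is passed. -/
def passProb (δ : ℝ) (ρ : Matrix (ABB' (s + k)) (ABB' (s + k)) ℂ) (p : Bits s × Bits s) : ℝ :=
  ∑ v : Bits k, ∑ w : Bits k, ∑ θ : BasisSeed s k, if comp δ v w then
    (((s + k).choose k : ℝ))⁻¹ * outcomeProb true ρ (v, w, p.1, p.2, θ) else 0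

theorem passProb_nonneg (δ : ℝ) {ρ : Matrix (ABB' (s + k)) (ABB' (s + k)) ℂ} (hρ : ρ.PosSemidef)
    (p : Bits s × Bits s) : 0 ≤ passProb δ ρ p := by
  refine Finset.sum_nonneg fun v _ => Finset.sum_nonneg fun w _ => Finset.sum_nonneg fun θ _ => ?_
  split_ifs
  · exact mul_nonneg (by positivity) (trace_totalMeas_eq true hρ _).2
  · exact le_rfl

theorem stateZYComp_postMeasState (δ : ℝ) {ρ : Matrix (ABB' (s + k)) (ABB' (s + k)) ℂ}
    (hρ : ρ.PosSemidef) :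
    stateZYComp δ (postMeasState true ρ) = classicalState (passProb δ ρ) := by
  classical
  ext p q
  simp only [stateZYComp, Matrix.of_apply, postMeasState_eq _ hρ, classicalState]
  by_cases h : p = q
  · subst h
    simp only [Matrix.diagonal_apply_eq, passProb, Complex.ofReal_sum]
    refine Finset.sum_congr rfl fun v _ => Finset.sum_congr rfl fun w _ =>
      Finset.sum_congr rfl fun θ _ => ?_
    split_ifs <;> simp
  · rw [Matrix.diagonal_apply_ne _ h]
    refine Finset.sum_eq_zero fun v _ => Finset.sum_eq_zero fun w _ =>
      Finset.sum_eq_zero fun θ _ => ?_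
    split_ifs
    · exact Matrix.diagonal_apply_ne _ fun h' => h (by
        simp only [Prod.mk.injEq, true_and] at h'
        exact Prod.ext h'.1 h'.2.1)
    · rfl

theorem sum_passProb (δ : ℝ) {ρ : Matrix (ABB' (s + k)) (ABB' (s + k)) ℂ} (hρ : ρ.PosSemidef) :
    ∑ p, passProb δ ρ p = probComp δ (postMeasState true ρ) := by
  classical
  simp only [probComp, postMeasState_eq _ hρ, Matrix.diagonal_apply_eq, Complex.ofReal_re,
    Fintype.sum_prod_type, passProb]
  rw [Finset.sum_congr rfl fun z _ => Finset.sum_comm, Finset.sum_comm]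
  refine Finset.sum_congr rfl fun v _ => ?_
  rw [Finset.sum_congr rfl fun z _ => Finset.sum_comm, Finset.sum_comm]

/-- Any seed will do: cutting both strings along it turns the joint probability into an outcome
probability. -/
theorem jointProb_nonneg {ρ : Matrix (ABB' (s + k)) (ABB' (s + k)) ℂ} (hρ : ρ.PosSemidef)
    (θ : BasisSeed s k) (a b : Bits (s + k)) : 0 ≤ jointProb ρ a b := by
  obtain ⟨⟨z, v⟩, rfl⟩ := (glueEquiv θ).surjective a
  obtain ⟨⟨y, w⟩, rfl⟩ := (glueEquiv θ).surjective b
  have := (trace_totalMeas_eq true hρ (v, w, z, y, θ)).2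
  rwa [outcomeProb_true] at this

open Classical in
/-- Events of the outcomes have the probability obtained by first sampling two strings and then
an independent seed. -/
theorem sum_passProb_filter (δ : ℝ) (ρ : Matrix (ABB' (s + k)) (ABB' (s + k)) ℂ)
    (G : Finset (Bits s × Bits s)) :
    ∑ p ∈ G, passProb δ ρ p = ∑ a, ∑ b, (((s + k).choose k : ℝ))⁻¹ *
      (Finset.univ.filter fun θ : BasisSeed s k =>
        ((fun j => a (posI θ j), fun j => b (posI θ j)) : Bits s × Bits s) ∈ G ∧
          comp δ (fun j => a (posIbar θ j)) (fun j => b (posIbar θ j))).card * jointProb ρ a b := by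
  have hθ : ∀ θ : BasisSeed s k,
      ∑ p : Bits s × Bits s, ∑ v : Bits k, ∑ w : Bits k, (if p ∈ G ∧ comp δ v w then
        (((s + k).choose k : ℝ))⁻¹ * outcomeProb true ρ (v, w, p.1, p.2, θ) else 0)
      = ∑ a, ∑ b, if ((fun j => a (posI θ j), fun j => b (posI θ j)) : Bits s × Bits s) ∈ G ∧
          comp δ (fun j => a (posIbar θ j)) (fun j => b (posIbar θ j)) then
        (((s + k).choose k : ℝ))⁻¹ * jointProb ρ a b else 0 := fun θ => by
    -- For a fixed seed, summing over `(z, v)` and `(y, w)` is the same as summing over the full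
    -- strings `a` and `b`.
    rw [← Equiv.sum_comp (glueEquiv θ)]
    simp only [← Equiv.sum_comp (glueEquiv θ) (fun b => ite _ _ _), Fintype.sum_prod_type]
    simp only [glueEquiv, Equiv.coe_fn_mk, glue_posI, glue_posIbar, outcomeProb_true]
    refine Finset.sum_congr rfl fun z _ => ?_
    rw [Finset.sum_comm]
  calc ∑ p ∈ G, passProb δ ρ p
      = ∑ p, ∑ v : Bits k, ∑ w : Bits k, ∑ θ : BasisSeed s k, (if p ∈ G ∧ comp δ v w then
        (((s + k).choose k : ℝ))⁻¹ * outcomeProb true ρ (v, w, p.1, p.2, θ) else 0) := by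
        rw [← Finset.univ_inter G, ← Finset.sum_ite_mem]
        refine Finset.sum_congr rfl fun p _ => ?_
        by_cases hp : p ∈ G <;> simp [hp, passProb]
    _ = ∑ θ : BasisSeed s k, ∑ p, ∑ v : Bits k, ∑ w : Bits k, (if p ∈ G ∧ comp δ v w then
        (((s + k).choose k : ℝ))⁻¹ * outcomeProb true ρ (v, w, p.1, p.2, θ) else 0) := by
        rw [Finset.sum_comm (s := Finset.univ (α := BasisSeed s k))]
        refine Finset.sum_congr rfl fun p _ => ?_
        rw [Finset.sum_comm (s := Finset.univ (α := BasisSeed s k))]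
        refine Finset.sum_congr rfl fun v _ => ?_
        rw [Finset.sum_comm (s := Finset.univ (α := BasisSeed s k))]
    _ = _ := by
        rw [Finset.sum_congr rfl fun θ _ => hθ θ, Finset.sum_comm]
        refine Finset.sum_congr rfl fun a _ => ?_
        rw [Finset.sum_comm]
        refine Finset.sum_congr rfl fun b _ => ?_
        rw [← Finset.sum_filter, Finset.sum_const, nsmul_eq_mul]
        ring

/-- The positions where two strings differ. -/
def diffSet {n : ℕ} (a b : Bits n) : Finset (Fin n) := Finset.univ.filter fun i => a i ≠ b i

/-- The set `𝓘` of a seed. -/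
def seedSet (θ : BasisSeed s k) : Finset (Fin (s + k)) := Finset.univ.filter fun i => θ.1 i = false

theorem hammingWeight_posI (θ : BasisSeed s k) (a b : Bits (s + k)) :
    hammingWeight (bitXor (fun j => a (posI θ j)) fun j => b (posI θ j))
      = (seedSet θ ∩ diffSet a b).card := by
  rw [hammingWeight, ← Finset.card_map (posI θ).toEmbedding]
  congr 1
  ext i
  simp only [Finset.mem_map, Finset.mem_filter, Finset.mem_univ, true_and, bitXor, seedSet, diffSet,
    Finset.mem_inter, RelEmbedding.coe_toEmbedding, bne_iff_ne, ne_eq]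
  rw [← mem_range_posI]
  constructor
  · rintro ⟨j, hj, rfl⟩; exact ⟨⟨j, rfl⟩, hj⟩
  · rintro ⟨⟨j, rfl⟩, hj⟩; exact ⟨j, hj, rfl⟩

theorem hammingWeight_posIbar (θ : BasisSeed s k) (a b : Bits (s + k)) :
    hammingWeight (bitXor (fun j => a (posIbar θ j)) fun j => b (posIbar θ j))
      = (diffSet a b \ seedSet θ).card := by
  rw [hammingWeight, ← Finset.card_map (posIbar θ).toEmbedding]
  congr 1
  ext i
  simp only [Finset.mem_map, Finset.mem_filter, Finset.mem_univ, true_and, bitXor, seedSet, diffSet,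
    Finset.mem_sdiff, RelEmbedding.coe_toEmbedding, bne_iff_ne, ne_eq, Bool.not_eq_false]
  rw [← mem_range_posIbar]
  constructor
  · rintro ⟨j, hj, rfl⟩; exact ⟨hj, ⟨j, rfl⟩⟩
  · rintro ⟨hj, ⟨j, rfl⟩⟩; exact ⟨j, hj, rfl⟩

theorem card_seedSet (θ : BasisSeed s k) : (seedSet θ).card = s := by
  have h : seedSet θ = Finset.univ.map (posI θ).toEmbedding := by
    ext i
    simp only [seedSet, Finset.mem_map, Finset.mem_filter, Finset.mem_univ, true_and,
      RelEmbedding.coe_toEmbedding]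
    exact (mem_range_posI θ i).symm
  rw [h, Finset.card_map, Finset.card_fin]

theorem seedSet_injective : Function.Injective (seedSet : BasisSeed s k → _) := fun θ θ' h => by
  refine Subtype.ext (funext fun i => ?_)
  have := Finset.ext_iff.mp h i
  simp only [seedSet, Finset.mem_filter, Finset.mem_univ, true_and] at this
  cases h1 : θ.1 i <;> cases h2 : θ'.1 i <;> simp_all

-- A seed is determined by its set `𝓘` of size `s`, so counting seeds reduces to counting samples,
-- with the positions where `a` and `b` differ as marked elements.
open Classical in
theorem card_seed_le (hpos : 0 < s + k) (a b : Bits (s + k)) (δ ν : ℝ) (hν : 0 < ν) :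
    ((Finset.univ.filter fun θ : BasisSeed s k =>
      (s : ℝ) * (δ + ν) ≤ hammingWeight (bitXor (fun j => a (posI θ j)) fun j => b (posI θ j)) ∧
        comp δ (fun j => a (posIbar θ j)) (fun j => b (posIbar θ j))).card : ℝ)
      ≤ (s + k).choose k * smoothingParam s k ν ^ 2 := by
  rw [← Nat.choose_symm_add]
  refine le_trans ?_ (card_sample_le s k (by simp) hpos (diffSet a b) δ ν hν)
  rw [Nat.cast_le, ← Finset.card_image_of_injective _ seedSet_injective]
  refine Finset.card_le_card fun I hI => ?_
  obtain ⟨θ, hθ, rfl⟩ := Finset.mem_image.mp hI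
  simp only [Finset.mem_filter, Finset.mem_univ, true_and, comp, hammingWeight_posI,
    hammingWeight_posIbar] at hθ
  exact Finset.mem_filter.mpr ⟨Finset.mem_powersetCard.mpr ⟨Finset.subset_univ _, card_seedSet θ⟩,
    hθ.1, hθ.2.le⟩

theorem sum_jointProb_mul_le {m : ℕ} {ρ : Matrix (ABB' m) (ABB' m) ℂ} (hρ : ρ.trace = 1)
    (hnn : ∀ a b, 0 ≤ jointProb ρ a b) (c : Bits m → Bits m → ℝ) {C : ℝ} (hc : ∀ a b, c a b ≤ C) :
    ∑ a, ∑ b, c a b * jointProb ρ a b ≤ C := by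
  calc _ ≤ ∑ a, ∑ b, C * jointProb ρ a b := Finset.sum_le_sum fun a _ => Finset.sum_le_sum fun b _ =>
        mul_le_mul_of_nonneg_right (hc a b) (hnn a b)
    _ = C := by simp only [← Finset.mul_sum]; rw [sum_jointProb hρ, mul_one]

theorem nonempty_basisSeed (s k : ℕ) : Nonempty (BasisSeed s k) := by
  obtain ⟨I, -, hI⟩ := Finset.exists_subset_card_eq
    (s := (Finset.univ : Finset (Fin (s + k)))) (n := k) (by simp)
  exact ⟨fun i => decide (i ∈ I), by simp [hammingWeight, hI]⟩

theorem card_basisSeed_le (s k : ℕ) : Fintype.card (BasisSeed s k) ≤ (s + k).choose k := by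
  rw [← Finset.card_univ, ← Finset.card_image_of_injective _ seedSet_injective, ← Nat.choose_symm_add]
  refine (Finset.card_le_card (t := Finset.powersetCard s Finset.univ) fun I hI => ?_).trans
    (by simp)
  obtain ⟨θ, -, rfl⟩ := Finset.mem_image.mp hI
  exact Finset.mem_powersetCard.mpr ⟨Finset.subset_univ _, card_seedSet θ⟩

theorem sum_passProb_le_one (δ : ℝ) {ρ : Matrix (ABB' (s + k)) (ABB' (s + k)) ℂ}
    (hρ : IsDensity ρ) : ∑ p, passProb δ ρ p ≤ 1 := by
  classical
  have hC : (0 : ℝ) < (s + k).choose k := by exact_mod_cast Nat.choose_pos (by omega)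
  obtain ⟨θ₀⟩ := nonempty_basisSeed s k
  rw [sum_passProb_filter]
  refine sum_jointProb_mul_le hρ.2 (jointProb_nonneg hρ.1 θ₀) _ fun a b => ?_
  rw [inv_mul_le_iff₀ hC, mul_one, Nat.cast_le]
  exact (Finset.card_le_univ _).trans (card_basisSeed_le s k)

/-- The pairs of strings that differ in at most a fraction `r` of the positions. -/
def closePairs (s : ℕ) (r : ℝ) : Finset (Bits s × Bits s) :=
  open Classical in Finset.univ.filter fun p => (hammingWeight (bitXor p.1 p.2) : ℝ) ≤ s * r

/-- The bound on the fraction of bad seeds is uniform in the two strings, so it survives averaging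
over their joint law, whatever the correlations between them. -/
theorem sum_passProb_compl_le (hpos : 0 < s + k) (δ ν : ℝ) (hν : 0 < ν)
    {ρ : Matrix (ABB' (s + k)) (ABB' (s + k)) ℂ} (hρ : IsDensity ρ) :
    ∑ p ∈ (closePairs s (δ + ν))ᶜ, passProb δ ρ p ≤ smoothingParam s k ν ^ 2 := by
  classical
  have hC : (0 : ℝ) < (s + k).choose k := by exact_mod_cast Nat.choose_pos (by omega)
  obtain ⟨θ₀⟩ := nonempty_basisSeed s k
  rw [sum_passProb_filter]
  refine sum_jointProb_mul_le hρ.2 (jointProb_nonneg hρ.1 θ₀) _ fun a b => ?_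
  rw [inv_mul_le_iff₀ hC]
  refine le_trans ?_ (card_seed_le hpos a b δ ν hν)
  rw [Nat.cast_le]
  refine Finset.card_le_card fun θ hθ => ?_
  simp only [closePairs, Finset.mem_filter, Finset.mem_univ, true_and, Finset.mem_compl,
    not_le] at hθ ⊢
  exact ⟨hθ.1.le, hθ.2⟩

/-- Translation by `y` maps the fibre over `y` injectively into the Hamming ball around zero. -/
theorem card_closePairs_le (s : ℕ) {r : ℝ} (hr : 0 < r) (hr2 : r ≤ 1 / 2) (y : Bits s) :
    ((Finset.univ.filter fun z => (z, y) ∈ closePairs s r).card : ℝ) ≤ 2 ^ (s * binEnt r) := by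
  classical
  refine le_trans ?_ (card_hammingBall_le s hr hr2)
  have hinj : Function.Injective fun z : Bits s => bitXor z y := fun z z' h => funext fun i => by
    have := congrFun h i
    simpa [bitXor] using this
  rw [Nat.cast_le, ← Finset.card_image_of_injective _ hinj]
  refine Finset.card_le_card fun x hx => ?_
  obtain ⟨z, hz, rfl⟩ := Finset.mem_image.mp hx
  simpa [closePairs] using hz

end Comparison

end CertDel

end

theorem mainTheorem7 (s k : ℕ) (δ : ℝ) (hδ : δ ∈ Set.Icc (0 : ℝ) 1)
    (ρ : Matrix (CertDel.ABB' (s + k)) (CertDel.ABB' (s + k)) ℂ) (hρ : CertDel.IsDensity ρ) :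
    CertDel.probComp δ (CertDel.postMeasState false ρ)
        = CertDel.probComp δ (CertDel.postMeasState true ρ) ∧
      ∀ ν ∈ Set.Ioc (0 : ℝ) (1 / 2 - δ),
        CertDel.smoothingParam s k ν ^ 2 < CertDel.probComp δ (CertDel.postMeasState false ρ) →
          CertDel.smoothCondMaxEntropy (CertDel.smoothingParam s k ν)
              (CertDel.stateZYComp δ (CertDel.postMeasState true ρ))
            ≤ (((s : ℝ) * CertDel.binEnt (δ + ν) : ℝ) : EReal) := by
  refine ⟨CertDel.probComp_postMeasState false true δ hρ.1, fun ν hν hlt => ?_⟩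
  rw [CertDel.probComp_postMeasState false true δ hρ.1, ← CertDel.sum_passProb δ hρ.1] at hlt
  rw [CertDel.stateZYComp_postMeasState δ hρ.1]
  have hp := CertDel.passProb_nonneg δ hρ.1
  have hp1 := CertDel.sum_passProb_le_one δ hρ
  -- For `s = k = 0` the exponent evaluates to zero, so the smoothing parameter is one and cannot
  -- lie strictly below a probability.
  have hpos : 0 < s + k := by
    by_contra h
    obtain ⟨rfl, rfl⟩ : s = 0 ∧ k = 0 := by omega
    simp only [CertDel.smoothingParam, Nat.cast_zero, zero_mul, neg_zero, zero_div,
      Real.exp_zero, one_pow] at hlt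
    linarith
  set p := CertDel.passProb δ ρ with hpdef
  set G := CertDel.closePairs s (δ + ν) with hG
  have he : ∑ a ∈ Gᶜ, p a ≤ CertDel.smoothingParam s k ν ^ 2 :=
    CertDel.sum_passProb_compl_le hpos δ ν hν.1 hρ
  -- Here the assumption on `ν` enters: `e ≤ ε(ν)² < Pr[F^comp = 1] ≤ 1`, so dividing by `1 - e` is
  -- legitimate.
  have he1 : ∑ a ∈ Gᶜ, p a < 1 := by linarith
  have hnn : ∀ a, 0 ≤ if a ∈ G then p a / (1 - ∑ a ∈ Gᶜ, p a) else 0 := fun a => by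
    split_ifs
    · exact div_nonneg (hp a) (by linarith)
    · exact le_rfl
  have htr : ∑ a, (if a ∈ G then p a / (1 - ∑ a ∈ Gᶜ, p a) else 0) ≤ 1 := by
    rw [Finset.sum_ite_mem, Finset.univ_inter, ← Finset.sum_div, div_le_one (by linarith)]
    linarith [Finset.sum_add_sum_compl G p]
  have hsub := CertDel.trace_classicalState
    fun a => if a ∈ G then p a / (1 - ∑ a ∈ Gᶜ, p a) else 0
  -- The smoothing candidate is the distribution restricted to close pairs and rescaled by `1 / (1 -
  -- e)`.
  refine iInf_le_of_le _ (iInf_le_of_le ⟨CertDel.posSemidef_classicalState hnn, hsub.le.trans htr⟩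
    (iInf_le_of_le ?_ ?_))
  · rw [CertDel.purifiedDist_restrict hp hp1 G he1]
    exact Real.sqrt_le_iff.mpr ⟨(Real.exp_pos _).le, he⟩
  · refine CertDel.condMaxEntropy_le _ (hsub.le.trans htr)
      (fun y => Finset.univ.filter fun z => (z, y) ∈ G) (fun z y hzy => ?_) _ fun y =>
        CertDel.card_closePairs_le s (by linarith [hδ.1, hν.1]) (by linarith [hν.2]) y
    have hzy' : (z, y) ∉ G := by simpa using hzy
    simp [CertDel.classicalState, hzy']
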